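/- Let $(S_t)_{t\ge 0}$ be a standard Gamma process on a probability space $(\Omega,\mathcal F,P)$: $S_0=0$ a.s., independent increments, $S_t-S_s\sim\mathrm{Gamma}(t-s,1)$ (shape $t-s$, rate $1$) for $s<t$, and almost all paths nondecreasing and right-continuous. Let $f:[0,\infty)\to[0,\infty)$ be measurable and integrable on every bounded interval, put $\lambda_t f=\int_0^t f(x)\,dx$, and assume $\lambda_t f\to\infty$ as $t\to\infty$. Let $$R_t=\frac{\int_0^t f\,dS}{\lambda_t f},\qquad b_t=\frac{f(t)}{\lambda_t f},\qquad v_t=\frac{\int_0^t f(x)^2\,dx}{(\lambda_t f)^2}\in[0,\infty],$$ where $\int_0^t f\,dS$ is the pathwise Lebesgue–Stieltjes integral over $(0,t]$. For $1\le p<\infty$, $f$ is said to satisfy orderly divergence (OD) in $L^p$ if $R_t\in L^p(P)$ for all large $t$ and $\|R_t-1\|_{L^p(P)}\to 0$ as $t\to\infty$. Theorem. Suppose that $b_t$ is bounded as $t\to\infty$, i.e. there are $C,t_0$ with $b_t\le C$ for all $t\ge t_0$. Then: (a) $f$ satisfies OD in $L^2$ if and only if $v_t\to 0$ as $t\to\infty$.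 (b) If $f$ satisfies OD in $L^2$, then it satisfies OD in $L^p$ for every real $p\ge 2$ such that $\int_0^t f(x)^p\,dx<\infty$ for all $t>0$. -/

import Mathlib

open MeasureTheory ProbabilityTheory Filter Topology Set
open scoped NNReal ENNReal

namespace OrderlyDivergence

/-- `S` is a standard Gamma process on `[0, ∞)`: it starts at `0`, has independent increments,
`S t - S s` is Gamma distributed with shape `t - s` and rate `1` for `s < t` (so `S 1` is
exponential with mean `1`), and almost all of its paths are nondecreasing and right-continuous. -/
structure IsGammaProcess {Ω : Type*} [MeasurableSpace Ω] (S : ℝ≥0 → Ω → ℝ) (P : Measure Ω) :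
    Prop where
  zero : ∀ᵐ ω ∂P, S 0 ω = 0
  indep : HasIndepIncrements S P
  law : ∀ s t : ℝ≥0, s < t →
    HasLaw (fun ω => S t ω - S s ω) (gammaMeasure ((t : ℝ) - (s : ℝ)) 1) P
  paths : ∀ᵐ ω ∂P, Monotone (fun t => S t ω) ∧
    ∀ t, ContinuousWithinAt (fun r => S r ω) (Ici t) t

/-- A nondecreasing right-continuous path on `[0, ∞)`, extended to `ℝ` by its value at `0`. -/
noncomputable def stieltjesOfPath (g : ℝ≥0 → ℝ) (hm : Monotone g)
    (hc : ∀ t, ContinuousWithinAt g (Ici t) t) : StieltjesFunction ℝ where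
  toFun x := g x.toNNReal
  mono' := fun _ _ h => hm (Real.toNNReal_le_toNNReal h)
  right_continuous' x :=
    (hc x.toNNReal).comp continuous_real_toNNReal.continuousWithinAt
      (fun _ hy => Real.toNNReal_le_toNNReal hy)

open Classical in
/-- The Lebesgue–Stieltjes measure `dg` of a path `g` on `[0, ∞)`, with `dg (s, t] = g t - g s`
for `0 ≤ s ≤ t` (and the zero measure if `g` is not nondecreasing and right-continuous). -/
noncomputable def pathMeasure (g : ℝ≥0 → ℝ) : Measure ℝ :=
  if h : Monotone g ∧ ∀ t, ContinuousWithinAt g (Ici t) t then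
    (stieltjesOfPath g h.1 h.2).measure
  else 0

/-- The pathwise stochastic integral `∫₀ᵗ f dS`. -/
noncomputable def gammaIntegral {Ω : Type*} (S : ℝ≥0 → Ω → ℝ) (f : ℝ → ℝ) (t : ℝ) (ω : Ω) : ℝ :=
  ∫ x in Ioc 0 t, f x ∂(pathMeasure (fun r => S r ω))

/-- `λ_t f = ∫₀ᵗ f(x) dx`. -/
noncomputable def lam (f : ℝ → ℝ) (t : ℝ) : ℝ := ∫ x in Ioc 0 t, f x

/-- The normalized integral `R_t = (∫₀ᵗ f dS) / λ_t f`. -/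
noncomputable def R {Ω : Type*} (S : ℝ≥0 → Ω → ℝ) (f : ℝ → ℝ) (t : ℝ) (ω : Ω) : ℝ :=
  gammaIntegral S f t ω / lam f t

/-- `b_t = f(t) / λ_t f`. -/
noncomputable def b (f : ℝ → ℝ) (t : ℝ) : ℝ := f t / lam f t

/-- `v_t = λ_t(f²) / (λ_t f)²`, with value `∞` if `λ_t(f²) = ∞`. -/
noncomputable def v (f : ℝ → ℝ) (t : ℝ) : ℝ≥0∞ :=
  (∫⁻ x in Ioc 0 t, ENNReal.ofReal (f x ^ 2)) / ENNReal.ofReal (lam f t ^ 2)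

/-- Orderly divergence in `L^p`: `R_t → 1` in `L^p(P)` as `t → ∞`. -/
def ODLp {Ω : Type*} [MeasurableSpace Ω] (S : ℝ≥0 → Ω → ℝ) (P : Measure Ω) (f : ℝ → ℝ)
    (p : ℝ) : Prop :=
  (∀ᶠ t in atTop, MemLp (R S f t) (ENNReal.ofReal p) P) ∧
    Tendsto (fun t => eLpNorm (fun ω => R S f t ω - 1) (ENNReal.ofReal p) P) atTop (𝓝 0)

end OrderlyDivergence

/-! The random measure dS has Lebesgue measure as its mean, and `∫ f dS` over (0,t] has variance `∫
f²`, as an identity in [0,∞]. Hence `‖R_t - 1‖₂ = v_t^{1/2}` once `λ_t f > 0` (`eLpNorm_R_sub_one`),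
which is (a). These moments come from one principle, `lintegral_mul_lintegral_pathMeasure`: to
compute `E[W ∫ φ dS]` for a weight W ≥ 0 it is enough to know `E[W S_s]` for every s.

For (b), fix a beyond which `λ f > 0` and `f ≤ C λ f`, and cut f at a. The integral over (0,a] is
one fixed random variable, in L^p by `memLp_gammaIntegral`, so dividing it by `λ_t f → ∞` removes
it. On (a,t], monotonicity of λ gives `f(x) ≤ C λ_x f ≤ C λ_t f`, so `g = f / (2 C λ_t f)` is at
most 1/2 there. For functions bounded by 1/2 the Laplace transform of the Gamma law gives `E exp(∫ g
dS - ∫ g) ≤ exp(2 ∫ g²)` (`expBound`, `lintegral_exp_sub_le`). The same bound holds for -g, and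
`|y|^p ≤ K (e^y + e^{-y} - 2)` for p ≥ 2, so the p-th absolute moment of the centred integral is at
most `2 K (exp(2 ∫ g²) - 1)`. Since `∫ g² ≤ v_t → 0`, the tail vanishes in L^p too. -/

namespace OrderlyDivergence

/-! ### Gamma laws: size bias, Laplace transform, power moments. -/

section GammaMeasure

/-- Size biasing: by `Γ(a+1) = a Γ(a)`, multiplying the density of shape a by x gives a times the
density of shape a + 1. The first and second moments of the process, and its weighted moments, rest
on this. -/
lemma lintegral_ofReal_mul_gammaMeasure {a : ℝ} (ha : 0 < a) {φ : ℝ → ℝ≥0∞} (hφ : Measurable φ) :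
    ∫⁻ x, φ x * ENNReal.ofReal x ∂(gammaMeasure a 1)
      = ENNReal.ofReal a * ∫⁻ x, φ x ∂(gammaMeasure (a + 1) 1) := by
  have hm : ∀ c : ℝ, Measurable (gammaPDF c 1) := fun c =>
    (measurable_gammaPDFReal c 1).ennreal_ofReal
  rw [gammaMeasure, gammaMeasure, lintegral_withDensity_eq_lintegral_mul _ (hm _) (by fun_prop),
    lintegral_withDensity_eq_lintegral_mul _ (hm _) hφ,
    ← lintegral_const_mul _ ((hm _).mul hφ)]
  refine lintegral_congr fun x => ?_
  simp only [Pi.mul_apply]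
  have key : gammaPDF a 1 x * ENNReal.ofReal x = ENNReal.ofReal a * gammaPDF (a + 1) 1 x := by
    rcases lt_or_ge x 0 with hx | hx
    · simp [gammaPDF_of_neg hx]
    · rw [gammaPDF_of_nonneg hx, gammaPDF_of_nonneg hx, ← ENNReal.ofReal_mul' hx,
        ← ENNReal.ofReal_mul ha.le, Real.Gamma_add_one ha.ne']
      congr 1
      have hG := (Real.Gamma_pos_of_pos ha).ne'
      rcases hx.eq_or_lt with rfl | hx
      · simp [Real.zero_rpow ha.ne']
      · rw [Real.rpow_sub_one hx.ne', add_sub_cancel_right]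
        simp only [Real.one_rpow]
        field_simp
  rw [mul_comm (φ x), ← mul_assoc, key, mul_assoc]

lemma lintegral_exp_mul_gammaMeasure {a θ : ℝ} (ha : 0 < a) (hθ : θ < 1) :
    ∫⁻ x, ENNReal.ofReal (Real.exp (θ * x)) ∂(gammaMeasure a 1)
      = ENNReal.ofReal ((1 - θ) ^ (-a)) := by
  have hm : ∀ r : ℝ, Measurable (gammaPDF a r) := fun r =>
    (measurable_gammaPDFReal a r).ennreal_ofReal
  have h1 : 0 < 1 - θ := by linarith
  rw [gammaMeasure, lintegral_withDensity_eq_lintegral_mul _ (hm _) (by fun_prop)]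
  have key : ∀ x, (gammaPDF a 1 * fun x => ENNReal.ofReal (Real.exp (θ * x))) x
      = ENNReal.ofReal ((1 - θ) ^ (-a)) * gammaPDF a (1 - θ) x := by
    intro x
    simp only [Pi.mul_apply]
    rcases lt_or_ge x 0 with hx | hx
    · simp [gammaPDF_of_neg hx]
    · rw [gammaPDF_of_nonneg hx, gammaPDF_of_nonneg hx, ← ENNReal.ofReal_mul' (by positivity),
        ← ENNReal.ofReal_mul (by positivity), Real.rpow_neg h1.le, Real.one_rpow]
      congr 1
      have : (1 - θ) ^ a ≠ 0 := by positivity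
      have e : Real.exp (-((1 - θ) * x)) = Real.exp (-(1 * x)) * Real.exp (θ * x) := by
        rw [← Real.exp_add]; ring_nf
      rw [e]
      field_simp
  simp_rw [key]
  rw [lintegral_const_mul _ (hm _), lintegral_gammaPDF_eq_one ha h1, mul_one]

lemma lintegral_rpow_gammaMeasure_lt_top {a q : ℝ} (ha : 0 < a) (hq : 0 ≤ q) :
    ∫⁻ x, ENNReal.ofReal (x ^ q) ∂(gammaMeasure a 1) < ∞ := by
  have hm : ∀ c : ℝ, Measurable (gammaPDF c 1) := fun c =>
    (measurable_gammaPDFReal c 1).ennreal_ofReal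
  rw [gammaMeasure, lintegral_withDensity_eq_lintegral_mul _ (hm _) (by fun_prop)]
  have key : ∀ᵐ x ∂(volume : Measure ℝ), (gammaPDF a 1 * fun x => ENNReal.ofReal (x ^ q)) x
      = ENNReal.ofReal (Real.Gamma (a + q) / Real.Gamma a) * gammaPDF (a + q) 1 x := by
    -- The point 0 is discarded because `x^(a-1) * x^q = x^(a+q-1)` can fail there under the
    -- conventions for `rpow`, for instance when a = q = 1/2.
    filter_upwards [compl_mem_ae_iff.mpr (measure_singleton (0 : ℝ))] with x hx0
    simp only [Pi.mul_apply]
    have hGa := Real.Gamma_pos_of_pos ha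
    have hGq := Real.Gamma_pos_of_pos (show 0 < a + q by linarith)
    rcases lt_or_gt_of_ne hx0 with hx | hx
    · simp [gammaPDF_of_neg hx]
    · rw [gammaPDF_of_nonneg hx.le, gammaPDF_of_nonneg hx.le,
        ← ENNReal.ofReal_mul' (by positivity), ← ENNReal.ofReal_mul (by positivity)]
      congr 1
      rw [show a + q - 1 = (a - 1) + q by ring, Real.rpow_add hx]
      simp only [Real.one_rpow]
      field_simp
  rw [lintegral_congr_ae key, lintegral_const_mul _ (hm _),
    lintegral_gammaPDF_eq_one (by linarith) one_pos, mul_one]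
  exact ENNReal.ofReal_lt_top

end GammaMeasure

/-! ### Lebesgue–Stieltjes measures of single paths. -/

section PathMeasure

lemma pathMeasure_Ioc {g : ℝ≥0 → ℝ} (hm : Monotone g)
    (hc : ∀ t, ContinuousWithinAt g (Ici t) t) (a b : ℝ) :
    pathMeasure g (Ioc a b) = ENNReal.ofReal (g b.toNNReal - g a.toNNReal) := by
  rw [pathMeasure, dif_pos ⟨hm, hc⟩, StieltjesFunction.measure_Ioc]
  rfl

lemma pathMeasure_restrict_Iic {g : ℝ≥0 → ℝ} (hm : Monotone g)
    (hc : ∀ t, ContinuousWithinAt g (Ici t) t) (T s : ℝ) :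
    (pathMeasure g).restrict (Ioc 0 T) (Iic s)
      = ENNReal.ofReal (g (min T s).toNNReal - g 0) := by
  rw [Measure.restrict_apply measurableSet_Iic, inter_comm, Ioc_inter_Iic, pathMeasure_Ioc hm hc,
    Real.toNNReal_zero]

lemma isFiniteMeasure_pathMeasure_restrict {g : ℝ≥0 → ℝ} (hm : Monotone g)
    (hc : ∀ t, ContinuousWithinAt g (Ici t) t) (a b : ℝ) :
    IsFiniteMeasure ((pathMeasure g).restrict (Ioc a b)) :=
  ⟨by rw [Measure.restrict_apply_univ, pathMeasure_Ioc hm hc]; exact ENNReal.ofReal_lt_top⟩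

end PathMeasure

/-! ### The random measure dS: measurability and mean. -/

namespace IsGammaProcess

variable {Ω : Type*} [MeasurableSpace Ω] {P : Measure Ω} {S : ℝ≥0 → Ω → ℝ}

lemma hasLaw (hS : IsGammaProcess S P) {t : ℝ≥0} (ht : 0 < t) :
    HasLaw (S t) (gammaMeasure t 1) P := by
  have h := hS.law 0 t ht
  rw [NNReal.coe_zero, sub_zero] at h
  refine h.congr ?_
  filter_upwards [hS.zero] with ω hω
  simp [hω]

lemma aemeasurable (hS : IsGammaProcess S P) (t : ℝ≥0) : AEMeasurable (S t) P := by
  rcases eq_zero_or_pos t with rfl | ht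
  · exact (aemeasurable_const (b := (0 : ℝ))).congr (hS.zero.mono fun ω h => h.symm)
  · exact (hS.hasLaw ht).aemeasurable

/-- A modification of the process all of whose paths are regular and measurable in `ω`. -/
lemma exists_measurable_version (hS : IsGammaProcess S P) :
    ∃ S' : ℝ≥0 → Ω → ℝ, (∀ t, Measurable (S' t)) ∧
      (∀ ω, Monotone (fun t => S' t ω) ∧
        ∀ t, ContinuousWithinAt (fun r => S' r ω) (Ici t) t) ∧
      ∀ᵐ ω ∂P, (fun t => S t ω) = fun t => S' t ω := by
  classical
  -- Each `S t` is only a.e. measurable. Right-continuity recovers it from the countable grid k/n,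
  -- approached from the right by ⌈tn⌉/n, so a single null set covers all times.
  obtain ⟨q, hqdef⟩ : ∃ q : ℕ → ℕ → ℝ≥0, ∀ k n, q k n = (k : ℝ≥0) / n := ⟨_, fun _ _ => rfl⟩
  have hq : ∀ᵐ ω ∂P, ∀ k n, S (q k n) ω = (hS.aemeasurable (q k n)).mk _ ω := by
    rw [ae_all_iff]; intro k; rw [ae_all_iff]; intro n
    exact (hS.aemeasurable (q k n)).ae_eq_mk
  have hgood := hS.paths.and hq
  set G : Set Ω := (toMeasurable P {ω | ¬ _})ᶜ with hG
  have hGm : MeasurableSet G := (measurableSet_toMeasurable _ _).compl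
  have hGae : ∀ᵐ ω ∂P, ω ∈ G := by
    rw [ae_iff]
    simp only [hG, mem_compl_iff, not_not]
    rw [Set.ofPred_mem_eq, measure_toMeasurable]
    exact ae_iff.1 hgood
  have hGp : ∀ ω ∈ G, _ := fun ω hω => not_not.1 fun h => hω (subset_toMeasurable _ _ h)
  refine ⟨fun t => G.indicator (S t), fun t => ?_, fun ω => ?_, ?_⟩
  · have hqm : ∀ k n, Measurable (G.indicator (S (q k n))) := fun k n => by
      have : G.indicator (S (q k n)) = G.indicator ((hS.aemeasurable (q k n)).mk _) := by
        refine indicator_congr fun ω hω => (hGp ω hω).2 k n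
      rw [this]
      exact (hS.aemeasurable (q k n)).measurable_mk.indicator hGm
    refine measurable_of_tendsto_metrizable (f := fun n => G.indicator (S (q ⌈(t : ℝ) * n⌉₊ n)))
      (fun n => hqm _ n) ?_
    rw [tendsto_pi_nhds]
    intro ω
    by_cases hω : ω ∈ G
    · simp only [indicator_of_mem hω]
      have h1 : Tendsto (fun n : ℕ => q ⌈(t : ℝ) * n⌉₊ n) atTop (𝓝 t) := by
        rw [← NNReal.tendsto_coe]
        simp_rw [hqdef, NNReal.coe_div, NNReal.coe_natCast]
        exact (tendsto_nat_ceil_mul_div_atTop t.coe_nonneg).comp tendsto_natCast_atTop_atTop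
      have h2 : ∀ᶠ n : ℕ in atTop, q ⌈(t : ℝ) * n⌉₊ n ∈ Ici t := by
        filter_upwards [eventually_gt_atTop 0] with n hn
        have hn' : (0 : ℝ≥0) < n := by exact_mod_cast hn
        rw [mem_Ici, hqdef, le_div_iff₀ hn', ← NNReal.coe_le_coe]
        push_cast
        exact Nat.le_ceil _
      have h3 : Tendsto (fun r => S r ω) (𝓝[Ici t] t) (𝓝 (S t ω)) := (hGp ω hω).1.2 t
      have h4 : Tendsto (fun n : ℕ => q ⌈(t : ℝ) * n⌉₊ n) atTop (𝓝[Ici t] t) :=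
        tendsto_nhdsWithin_iff.2 ⟨h1, h2⟩
      exact h3.comp h4
    · simp [hω]
  · by_cases hω : ω ∈ G
    · simpa only [indicator_of_mem hω] using (hGp ω hω).1
    · simp only [indicator_of_notMem hω]
      exact ⟨monotone_const, fun t => continuousWithinAt_const⟩
  · filter_upwards [hGae] with ω hω
    ext t
    simp [indicator_of_mem hω]

lemma aemeasurable_pathMeasure (hS : IsGammaProcess S P) (T : ℝ) :
    AEMeasurable (fun ω => (pathMeasure (fun r => S r ω)).restrict (Ioc 0 T)) P := by
  obtain ⟨S', hm, hp, he⟩ := hS.exists_measurable_version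
  refine ⟨fun ω => (pathMeasure (fun r => S' r ω)).restrict (Ioc 0 T), ?_, ?_⟩
  · have := fun ω => isFiniteMeasure_pathMeasure_restrict (hp ω).1 (hp ω).2 0 T
    refine Measurable.measure_of_isPiSystem (borel_eq_generateFrom_Iic ℝ) isPiSystem_Iic ?_ ?_
    · rintro _ ⟨s, rfl⟩
      simp_rw [fun ω => pathMeasure_restrict_Iic (hp ω).1 (hp ω).2 T s]
      exact ((hm _).sub (hm _)).ennreal_ofReal
    · simp_rw [Measure.restrict_apply_univ, fun ω => pathMeasure_Ioc (hp ω).1 (hp ω).2]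
      exact ((hm _).sub (hm _)).ennreal_ofReal
  · filter_upwards [he] with ω hω
    simp only [hω]

/-- The measure `A ↦ E[W dS(A ∩ (0,T])]` is the mixture of the path measures under the weighted law
`W · P`. It is finite and agrees with ν restricted to (0,T] on all half-lines, hence equals it.
Every moment formula for `∫ φ dS` thereby reduces to a computation with `S s` alone. -/
lemma lintegral_mul_lintegral_pathMeasure (hS : IsGammaProcess S P) {W : Ω → ℝ≥0∞}
    (hW : AEMeasurable W P) {T : ℝ} {ν : Measure ℝ} (hν : ν (Ioc 0 T) ≠ ∞)
    (h : ∀ s : ℝ≥0, 0 < s → s ≤ T → ∫⁻ ω, W ω * ENNReal.ofReal (S s ω) ∂P = ν (Ioc 0 (s : ℝ)))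
    {φ : ℝ → ℝ≥0∞} (hφ : Measurable φ) :
    ∫⁻ ω, W ω * ∫⁻ x in Ioc 0 T, φ x ∂(pathMeasure (fun r => S r ω)) ∂P
      = ∫⁻ x in Ioc 0 T, φ x ∂ν := by
  set κ : Ω → Measure ℝ := fun ω => (pathMeasure (fun r => S r ω)).restrict (Ioc 0 T) with hκ
  have hκm : AEMeasurable κ P := hS.aemeasurable_pathMeasure T
  have hκm' : AEMeasurable κ (P.withDensity W) :=
    hκm.mono_ac (withDensity_absolutelyContinuous _ _)
  have hfin : IsFiniteMeasure (ν.restrict (Ioc 0 T)) :=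
    ⟨by rw [Measure.restrict_apply_univ]; exact hν.lt_top⟩
  have hκs : ∀ s : ℝ, AEMeasurable (fun ω => κ ω (Iic s)) P := fun s =>
    (Measure.measurable_coe measurableSet_Iic).comp_aemeasurable hκm
  have hκφ : AEMeasurable (fun ω => ∫⁻ x, φ x ∂(κ ω)) P :=
    (Measure.measurable_lintegral hφ).comp_aemeasurable hκm
  have hIic : ∀ s : ℝ, (P.withDensity W).bind κ (Iic s) = ν.restrict (Ioc 0 T) (Iic s) := by
    intro s
    rw [Measure.bind_apply measurableSet_Iic hκm',
      lintegral_withDensity_eq_lintegral_mul₀ hW (hκs s),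
      Measure.restrict_apply measurableSet_Iic, inter_comm, Ioc_inter_Iic]
    have hae : (W * fun ω => κ ω (Iic s)) =ᵐ[P]
        fun ω => W ω * ENNReal.ofReal (S (min T s).toNNReal ω) := by
      filter_upwards [hS.paths, hS.zero] with ω hω h0
      simp only [Pi.mul_apply, hκ]
      rw [pathMeasure_restrict_Iic hω.1 hω.2, h0, sub_zero]
    rw [lintegral_congr_ae hae]
    rcases le_or_gt (min T s) 0 with h0 | h0
    · rw [Real.toNNReal_of_nonpos h0, Ioc_eq_empty (not_lt.2 h0), measure_empty,
        ← lintegral_zero (μ := P)]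
      refine lintegral_congr_ae ?_
      filter_upwards [hS.zero] with ω h0
      simp [h0]
    · rw [h _ (Real.toNNReal_pos.2 h0) (by rw [Real.coe_toNNReal _ h0.le]; exact min_le_left _ _),
        Real.coe_toNNReal _ h0.le]
  have hfin' : IsFiniteMeasure ((P.withDensity W).bind κ) := by
    refine ⟨?_⟩
    -- Agreement on half-lines gives finiteness only up to T, so the mass beyond T is treated
    -- separately.
    have h1 : (P.withDensity W).bind κ (Ioi T) = 0 := by
      rw [Measure.bind_apply measurableSet_Ioi hκm']
      have : Ioi T ∩ Ioc 0 T = ∅ := by ext x; simp; grind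
      simp [hκ, Measure.restrict_apply measurableSet_Ioi, this]
    calc (P.withDensity W).bind κ univ
        ≤ (P.withDensity W).bind κ (Iic T) + (P.withDensity W).bind κ (Ioi T) := by
          rw [← Iic_union_Ioi]; exact measure_union_le _ _
      _ = ν.restrict (Ioc 0 T) (Iic T) := by rw [h1, hIic, add_zero]
      _ < ∞ := measure_lt_top _ _
  have hbind := Measure.ext_of_Iic _ _ hIic
  rw [← hbind, Measure.lintegral_bind hκm' hφ.aemeasurable,
    lintegral_withDensity_eq_lintegral_mul₀ hW hκφ]
  rfl

lemma aemeasurable_lintegral_pathMeasure (hS : IsGammaProcess S P) (T : ℝ)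
    {φ : ℝ → ℝ≥0∞} (hφ : Measurable φ) :
    AEMeasurable (fun ω => ∫⁻ x in Ioc 0 T, φ x ∂(pathMeasure (fun r => S r ω))) P :=
  (Measure.measurable_lintegral hφ).comp_aemeasurable (hS.aemeasurable_pathMeasure T)

lemma lintegral_ofReal (hS : IsGammaProcess S P) (t : ℝ≥0) :
    ∫⁻ ω, ENNReal.ofReal (S t ω) ∂P = t := by
  rcases eq_zero_or_pos t with rfl | ht
  · rw [ENNReal.coe_zero, ← lintegral_zero (μ := P)]
    refine lintegral_congr_ae ?_
    filter_upwards [hS.zero] with ω h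
    simp [h]
  · have ht' : (0 : ℝ) < t := ht
    have := isProbabilityMeasure_gammaMeasure (show (0 : ℝ) < t + 1 by positivity) one_pos
    rw [(hS.hasLaw ht).lintegral_comp (by fun_prop)]
    have := lintegral_ofReal_mul_gammaMeasure ht' (φ := fun _ => 1) (by fun_prop)
    simpa using this

lemma lintegral_rpow_lt_top (hS : IsGammaProcess S P) {t : ℝ≥0} (ht : 0 < t) {q : ℝ}
    (hq : 0 ≤ q) : ∫⁻ ω, ENNReal.ofReal (S t ω ^ q) ∂P < ∞ := by
  rw [(hS.hasLaw ht).lintegral_comp (f := fun x => ENNReal.ofReal (x ^ q)) (by fun_prop)]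
  exact lintegral_rpow_gammaMeasure_lt_top ht hq

/-- The mean measure of a Gamma process is Lebesgue measure. -/
lemma lintegral_lintegral_pathMeasure (hS : IsGammaProcess S P) (T : ℝ)
    {φ : ℝ → ℝ≥0∞} (hφ : Measurable φ) :
    ∫⁻ ω, ∫⁻ x in Ioc 0 T, φ x ∂(pathMeasure (fun r => S r ω)) ∂P = ∫⁻ x in Ioc 0 T, φ x := by
  have := hS.lintegral_mul_lintegral_pathMeasure (W := fun _ => 1) aemeasurable_const
    (T := T) (ν := volume) (by simp) (fun s _ _ => by simp [hS.lintegral_ofReal]) hφ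
  simpa using this

/-! ### Weighted first moments and second moments. -/

variable [IsProbabilityMeasure P]

lemma lintegral_pair (hS : IsGammaProcess S P) {r t : ℝ≥0} (hr : 0 < r) (hrt : r < t)
    {ψ : ℝ × ℝ → ℝ≥0∞} (hψ : Measurable ψ) :
    ∫⁻ ω, ψ (S r ω, S t ω - S r ω) ∂P
      = ∫⁻ y, ∫⁻ x, ψ (x, y) ∂(gammaMeasure r 1) ∂(gammaMeasure ((t : ℝ) - r) 1) := by
  have hr' : (0 : ℝ) < r := hr
  have hrt' : (0 : ℝ) < (t : ℝ) - r := sub_pos.2 hrt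
  have := isProbabilityMeasure_gammaMeasure hr' one_pos
  have := isProbabilityMeasure_gammaMeasure hrt' one_pos
  have hi : IndepFun (S r) (S t - S r) P :=
    hS.indep.indepFun_eval_sub (zero_le (a := r)) hrt.le hS.zero
  have h1 := hS.hasLaw hr
  have h2 := hS.law r t hrt
  have hmap := (indepFun_iff_map_prod_eq_prod_map_map h1.aemeasurable h2.aemeasurable).1 hi
  rw [h1.map_eq] at hmap
  have h2' : Measure.map (S t - S r) P = gammaMeasure ((t : ℝ) - r) 1 := h2.map_eq
  rw [show (fun ω => S t ω - S r ω) = S t - S r from rfl, h2'] at hmap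
  rw [← lintegral_prod_symm' _ hψ, ← hmap,
    lintegral_map' hψ.aemeasurable (h1.aemeasurable.prodMk h2.aemeasurable)]

/-- Write `S t` as `S r` plus an independent increment. Size biasing raises the shape of `S r` from
r to r + 1 and leaves the increment alone, so the sum acquires the law of `S (t + 1)`. -/
lemma lintegral_mul_ofReal_of_lt (hS : IsGammaProcess S P) {r t : ℝ≥0} (hr : 0 < r) (hrt : r < t)
    {φ : ℝ → ℝ≥0∞} (hφ : Measurable φ) :
    ∫⁻ ω, φ (S t ω) * ENNReal.ofReal (S r ω) ∂P = r * ∫⁻ ω, φ (S (t + 1) ω) ∂P := by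
  have h1 := hS.lintegral_pair hr hrt (ψ := fun p => φ (p.1 + p.2) * ENNReal.ofReal p.1)
    (by fun_prop)
  -- Shifting both times by 1 keeps the increment's shape t - r and gives the first part the
  -- size-biased shape r + 1.
  have h2 := hS.lintegral_pair (r := r + 1) (t := t + 1) (by positivity) (by gcongr)
    (ψ := fun p => φ (p.1 + p.2)) (by fun_prop)
  simp only [add_sub_cancel] at h1 h2
  rw [h1, h2]
  have hr' : (0 : ℝ) < r := hr
  have e : ((t + 1 : ℝ≥0) : ℝ) - ((r + 1 : ℝ≥0) : ℝ) = (t : ℝ) - r := by push_cast; ring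
  have hp := isProbabilityMeasure_gammaMeasure (show (0 : ℝ) < r + 1 by positivity) one_pos
  rw [e, ← lintegral_const_mul]
  · refine lintegral_congr fun y => ?_
    rw [lintegral_ofReal_mul_gammaMeasure hr' (φ := fun x => φ (x + y)) (by fun_prop)]
    simp
  · push_cast
    exact Measurable.lintegral_prod_left' (f := fun p : ℝ × ℝ => φ (p.1 + p.2)) (by fun_prop)

lemma lintegral_ofReal_mul_ofReal (hS : IsGammaProcess S P) {r s : ℝ≥0} (hr : 0 < r) (hs : 0 < s) :
    ∫⁻ ω, ENNReal.ofReal (S r ω) * ENNReal.ofReal (S s ω) ∂P = r * s + min r s := by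
  rcases lt_trichotomy r s with h | rfl | h
  · simp_rw [mul_comm (ENNReal.ofReal (S r _))]
    rw [hS.lintegral_mul_ofReal_of_lt hr h ENNReal.measurable_ofReal, hS.lintegral_ofReal,
      min_eq_left h.le]
    push_cast; ring
  · have hr' : (0 : ℝ) < r := hr
    rw [(hS.hasLaw hr).lintegral_comp (f := fun x => ENNReal.ofReal x * ENNReal.ofReal x)
      (by fun_prop), lintegral_ofReal_mul_gammaMeasure hr' ENNReal.measurable_ofReal]
    have h1 := hS.lintegral_ofReal (r + 1)
    rw [(hS.hasLaw (by positivity)).lintegral_comp (by fun_prop)] at h1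
    push_cast at h1
    rw [h1]
    simp [mul_add]
  · rw [hS.lintegral_mul_ofReal_of_lt hs h ENNReal.measurable_ofReal, hS.lintegral_ofReal,
      min_eq_right h.le]
    push_cast; ring

lemma lintegral_rpow_mul_lintegral_pathMeasure (hS : IsGammaProcess S P) (T : ℝ≥0) {q : ℝ}
    (hq : 0 ≤ q) {φ : ℝ → ℝ≥0∞} (hφ : Measurable φ) :
    ∫⁻ ω, ENNReal.ofReal (S (T + 1) ω ^ q) *
        ∫⁻ x in Ioc 0 (T : ℝ), φ x ∂(pathMeasure (fun r => S r ω)) ∂P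
      = (∫⁻ ω, ENNReal.ofReal (S (T + 2) ω ^ q) ∂P) * ∫⁻ x in Ioc 0 (T : ℝ), φ x := by
  have hc := (hS.lintegral_rpow_lt_top (t := T + 2) (by positivity) hq).ne
  rw [hS.lintegral_mul_lintegral_pathMeasure
    (ν := (∫⁻ ω, ENNReal.ofReal (S (T + 2) ω ^ q) ∂P) • volume)
    (((hS.aemeasurable _).pow_const q).ennreal_ofReal) (ENNReal.mul_ne_top hc (by simp)) ?_ hφ,
    Measure.restrict_smul, lintegral_smul_measure, smul_eq_mul]
  intro s hs hsT
  -- The weight lives at T + 1 instead of T so that every s ≤ T lies strictly below it and the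
  -- increment has positive shape.
  have hsT' : s < T + 1 := lt_of_le_of_lt (by exact_mod_cast hsT) (lt_add_one T)
  rw [hS.lintegral_mul_ofReal_of_lt hs hsT' (φ := fun x => ENNReal.ofReal (x ^ q)) (by fun_prop),
    add_assoc, one_add_one_eq_two, Measure.smul_apply, Real.volume_Ioc]
  simp [mul_comm]

lemma lintegral_ofReal_mul_lintegral_pathMeasure (hS : IsGammaProcess S P) {T : ℝ} {r : ℝ≥0}
    (hr : 0 < r) (hrT : r ≤ T) {φ : ℝ → ℝ≥0∞} (hφ : Measurable φ) :
    ∫⁻ ω, ENNReal.ofReal (S r ω) * ∫⁻ x in Ioc 0 T, φ x ∂(pathMeasure (fun r => S r ω)) ∂P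
      = r * (∫⁻ x in Ioc 0 T, φ x) + ∫⁻ x in Ioc 0 (r : ℝ), φ x := by
  -- This ν encodes `E[S_r S_s] = r s + min r s`: the product of means, plus the covariance.
  rw [hS.lintegral_mul_lintegral_pathMeasure (ν := (r : ℝ≥0∞) • volume + volume.restrict (Ioc 0 (r : ℝ)))
    (hS.aemeasurable r).ennreal_ofReal ?_ ?_ hφ, Measure.restrict_add, lintegral_add_measure,
    Measure.restrict_smul, lintegral_smul_measure, smul_eq_mul,
    Measure.restrict_restrict measurableSet_Ioc, inter_eq_right.2 (Ioc_subset_Ioc_right hrT)]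
  · rw [Measure.add_apply, Measure.smul_apply, smul_eq_mul]
    exact ENNReal.add_ne_top.2 ⟨ENNReal.mul_ne_top (by simp) (by simp), measure_ne_top _ _⟩
  · intro s hs hsT
    rw [hS.lintegral_ofReal_mul_ofReal hr hs, Measure.add_apply, Measure.smul_apply, smul_eq_mul,
      Measure.restrict_apply measurableSet_Ioc, Ioc_inter_Ioc, Real.volume_Ioc, Real.volume_Ioc]
    simp only [sub_zero, max_self]
    rw [← NNReal.coe_min, ENNReal.ofReal_coe_nnreal, ENNReal.ofReal_coe_nnreal, min_comm,
      ENNReal.coe_min]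

/-- The second moment of the integral of a nonnegative function. -/
lemma lintegral_sq_lintegral_pathMeasure (hS : IsGammaProcess S P) {T : ℝ}
    {φ : ℝ → ℝ≥0∞} (hφ : Measurable φ) (hfin : ∫⁻ x in Ioc 0 T, φ x ≠ ∞) :
    ∫⁻ ω, (∫⁻ x in Ioc 0 T, φ x ∂(pathMeasure (fun r => S r ω))) ^ 2 ∂P
      = (∫⁻ x in Ioc 0 T, φ x) ^ 2 + ∫⁻ x in Ioc 0 T, φ x ^ 2 := by
  simp_rw [pow_two]
  -- The weight is now `∫ φ dS` itself; its products with `S s` are supplied by the preceding lemma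
  -- with the roles of weight and integrand exchanged.
  rw [hS.lintegral_mul_lintegral_pathMeasure
    (ν := (∫⁻ x in Ioc 0 T, φ x) • volume + volume.withDensity φ)
    (hS.aemeasurable_lintegral_pathMeasure T hφ) ?_ ?_ hφ, Measure.restrict_add,
    lintegral_add_measure, Measure.restrict_smul, lintegral_smul_measure, smul_eq_mul,
    restrict_withDensity measurableSet_Ioc, lintegral_withDensity_eq_lintegral_mul _ hφ hφ]
  · rfl
  · rw [Measure.add_apply, Measure.smul_apply, smul_eq_mul, withDensity_apply _ measurableSet_Ioc]
    exact ENNReal.add_ne_top.2 ⟨ENNReal.mul_ne_top hfin (by simp), hfin⟩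
  · intro s hs hsT
    simp_rw [mul_comm _ (ENNReal.ofReal (S s _))]
    rw [hS.lintegral_ofReal_mul_lintegral_pathMeasure hs hsT hφ, Measure.add_apply,
      Measure.smul_apply, smul_eq_mul, withDensity_apply _ measurableSet_Ioc, Real.volume_Ioc,
      sub_zero, ENNReal.ofReal_coe_nnreal, mul_comm]

end IsGammaProcess

/-! ### Exponential moments, from step functions to measurable functions. -/

lemma one_sub_rpow_neg_le_exp {a c : ℝ} (ha : 0 ≤ a) (hc : |c| ≤ 1 / 2) :
    (1 - c) ^ (-a) ≤ Real.exp ((c + 2 * c ^ 2) * a) := by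
  have hc' := abs_le.1 hc
  have h1 : 0 < 1 - c := by linarith
  have h := Real.abs_log_sub_add_sum_range_le (x := c) (by linarith) 1
  simp only [Finset.range_one, Finset.sum_singleton, zero_add, pow_one, Nat.cast_zero, div_one,
    one_add_one_eq_two, sq_abs] at h
  -- The remainder in `-log(1 - c) = c + ...` is at most `c² / (1 - |c|)`. The bound 1/2 on |c| is
  -- what makes the constant 2.
  have h2 : c ^ 2 / (1 - |c|) ≤ 2 * c ^ 2 := by
    rw [div_le_iff₀ (by linarith)]
    nlinarith [sq_nonneg c]
  have h3 := (abs_le.1 (h.trans h2)).1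
  rw [Real.rpow_def_of_pos h1, Real.exp_le_exp]
  nlinarith

namespace IsGammaProcess

variable {Ω : Type*} [MeasurableSpace Ω] {P : Measure Ω} {S : ℝ≥0 → Ω → ℝ}

lemma ae_integrableOn_pathMeasure (hS : IsGammaProcess S P) {g : ℝ → ℝ} (hg : Measurable g)
    {T : ℝ} (hi : IntegrableOn g (Ioc 0 T)) :
    ∀ᵐ ω ∂P, IntegrableOn g (Ioc 0 T) (pathMeasure (fun r => S r ω)) := by
  have hm : Measurable fun x => ‖g x‖ₑ := hg.enorm
  have h1 := hS.lintegral_lintegral_pathMeasure T hm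
  have h2 := ae_lt_top' (hS.aemeasurable_lintegral_pathMeasure T hm) (by rw [h1]; exact hi.2.ne)
  filter_upwards [h2] with ω hω
  exact ⟨hg.aestronglyMeasurable, hω⟩

lemma aemeasurable_integral_pathMeasure (hS : IsGammaProcess S P) {g : ℝ → ℝ} (hg : Measurable g)
    {T : ℝ} (hi : IntegrableOn g (Ioc 0 T)) :
    AEMeasurable (fun ω => ∫ x in Ioc 0 T, g x ∂(pathMeasure (fun r => S r ω))) P := by
  refine (((hS.aemeasurable_lintegral_pathMeasure T (φ := fun x => ENNReal.ofReal (g x))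
    (by fun_prop)).ennreal_toReal).sub ((hS.aemeasurable_lintegral_pathMeasure T
    (φ := fun x => ENNReal.ofReal (-g x)) (by fun_prop)).ennreal_toReal)).congr ?_
  filter_upwards [hS.ae_integrableOn_pathMeasure hg hi] with ω hω
  exact (integral_eq_lintegral_pos_part_sub_lintegral_neg_part hω).symm

/-- A Lebesgue-null set has expected dS-measure zero, hence is null for almost every path. This lets
Lebesgue-a.e. convergence be used pathwise. -/
lemma ae_ae_pathMeasure (hS : IsGammaProcess S P) {T : ℝ} {p : ℝ → Prop}
    (hp : ∀ᵐ x ∂(volume.restrict (Ioc 0 T)), p x) :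
    ∀ᵐ ω ∂P, ∀ᵐ x ∂((pathMeasure (fun r => S r ω)).restrict (Ioc 0 T)), p x := by
  obtain ⟨N, hN, hNm, hN0⟩ := exists_measurable_superset_of_null (ae_iff.1 hp)
  have h1 := hS.lintegral_lintegral_pathMeasure T (φ := N.indicator 1)
    (measurable_one.indicator hNm)
  rw [lintegral_indicator_one hNm, hN0, lintegral_eq_zero_iff'
    (hS.aemeasurable_lintegral_pathMeasure T (measurable_one.indicator hNm))] at h1
  filter_upwards [h1] with ω hω
  simp only [lintegral_indicator_one hNm, Pi.zero_apply] at hω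
  exact measure_mono_null hN hω

/-- The exponential bound for step functions. -/
lemma lintegral_exp_sum_le (hS : IsGammaProcess S P) {t : ℕ → ℝ≥0} (ht : StrictMono t) (n : ℕ)
    {c : ℕ → ℝ} (hc : ∀ k, |c k| ≤ 1 / 2) :
    ∫⁻ ω, ENNReal.ofReal (Real.exp (∑ k ∈ Finset.range n,
        c k * (S (t (k + 1)) ω - S (t k) ω))) ∂P
      ≤ ENNReal.ofReal (Real.exp (∑ k ∈ Finset.range n,
        (c k + 2 * c k ^ 2) * ((t (k + 1) : ℝ) - t k))) := by
  have hlt : ∀ k, t k < t (k + 1) := fun k => ht (Nat.lt_succ_self k)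
  have hlaw := fun k => hS.law _ _ (hlt k)
  let X : ℕ → Ω → ℝ≥0∞ := fun k ω =>
    ENNReal.ofReal (Real.exp (c k * (S (t (k + 1)) ω - S (t k) ω)))
  have hXi : iIndepFun X P :=
    (hS.indep.nat ht.monotone).comp (fun k x => ENNReal.ofReal (Real.exp (c k * x)))
      (fun k => by fun_prop)
  have hXm : ∀ k, AEMeasurable (X k) P := fun k =>
    (((hlaw k).aemeasurable.const_mul (c k)).exp).ennreal_ofReal
  -- The factors are replaced by measurable versions, since the expectation of the product is
  -- factored for measurable functions.
  have hX' : iIndepFun (fun k => (hXm k).mk (X k)) P := hXi.congr fun k => (hXm k).ae_eq_mk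
  have hprod := lintegral_prod_eq_prod_lintegral_of_indepFun (Finset.range n) _ hX'
    fun k => (hXm k).measurable_mk
  have hle : ∀ k, ∫⁻ ω, X k ω ∂P
      ≤ ENNReal.ofReal (Real.exp ((c k + 2 * c k ^ 2) * ((t (k + 1) : ℝ) - t k))) := by
    intro k
    have hpos : (0 : ℝ) < (t (k + 1) : ℝ) - t k := sub_pos.2 (hlt k)
    rw [(hlaw k).lintegral_comp (f := fun x => ENNReal.ofReal (Real.exp (c k * x))) (by fun_prop),
      lintegral_exp_mul_gammaMeasure hpos (by linarith [(abs_le.1 (hc k)).2])]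
    exact ENNReal.ofReal_le_ofReal (one_sub_rpow_neg_le_exp hpos.le (hc k))
  calc _ = ∫⁻ ω, ∏ k ∈ Finset.range n, (hXm k).mk (X k) ω ∂P := by
        refine lintegral_congr_ae ?_
        filter_upwards [ae_all_iff.2 fun k => (hXm k).ae_eq_mk] with ω hω
        simp_rw [← hω, X]
        rw [Real.exp_sum, ENNReal.ofReal_prod_of_nonneg fun _ _ => (Real.exp_pos _).le]
    _ = ∏ k ∈ Finset.range n, ∫⁻ ω, X k ω ∂P := by
        rw [hprod]
        exact Finset.prod_congr rfl fun k _ => lintegral_congr_ae (hXm k).ae_eq_mk.symm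
    _ ≤ ∏ k ∈ Finset.range n, _ := Finset.prod_le_prod' fun k _ => hle k
    _ = _ := by rw [Real.exp_sum, ENNReal.ofReal_prod_of_nonneg fun _ _ => (Real.exp_pos _).le]

end IsGammaProcess

/-- The bound on the exponential moment of `∫₀ᵀ g dS`. -/
def ExpBound {Ω : Type*} [MeasurableSpace Ω] (S : ℝ≥0 → Ω → ℝ) (P : Measure Ω) (T : ℝ)
    (g : ℝ → ℝ) : Prop :=
  ∫⁻ ω, ENNReal.ofReal (Real.exp (∫ x in Ioc 0 T, g x ∂(pathMeasure (fun r => S r ω)))) ∂P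
    ≤ ENNReal.ofReal (Real.exp (∫ x in Ioc 0 T, (g x + 2 * g x ^ 2)))

namespace IsGammaProcess

variable {Ω : Type*} [MeasurableSpace Ω] {P : Measure Ω} {S : ℝ≥0 → Ω → ℝ}

/-- Dominated convergence gives convergence of the integrals along almost every path and on the
Lebesgue side; Fatou's lemma then passes the inequality to the limit. The uniform bound is an
integrable dominating function because almost every path measure is finite on (0,T]. -/
lemma expBound_of_tendsto (hS : IsGammaProcess S P) {T : ℝ} {h : ℕ → ℝ → ℝ} {g : ℝ → ℝ}
    (hm : ∀ n, Measurable (h n)) (hb : ∀ n x, |h n x| ≤ 1 / 2)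
    (hE : ∀ n, ExpBound S P T (h n))
    (hlim : ∀ᵐ x ∂(volume.restrict (Ioc 0 T)), Tendsto (fun n => h n x) atTop (𝓝 (g x))) :
    ExpBound S P T g := by
  have hint : ∀ n, IntegrableOn (h n) (Ioc 0 T) := fun n =>
    Integrable.of_bound (hm n).aestronglyMeasurable (1 / 2) (ae_of_all _ fun x => hb n x)
  have hmeas : ∀ n, AEMeasurable (fun ω => ENNReal.ofReal (Real.exp
      (∫ x in Ioc 0 T, h n x ∂(pathMeasure (fun r => S r ω))))) P := fun n =>
    (hS.aemeasurable_integral_pathMeasure (hm n) (hint n)).exp.ennreal_ofReal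
  have hR : Tendsto (fun n => ∫ x in Ioc 0 T, (h n x + 2 * h n x ^ 2)) atTop
      (𝓝 (∫ x in Ioc 0 T, (g x + 2 * g x ^ 2))) := by
    refine tendsto_integral_of_dominated_convergence (fun _ => 1) (fun n => ?_)
      (integrable_const _) (fun n => ae_of_all _ fun x => ?_) ?_
    · exact ((hm n).add (((hm n).pow_const 2).const_mul 2)).aestronglyMeasurable
    · have := abs_le.1 (hb n x)
      rw [Real.norm_eq_abs, abs_le]
      constructor <;> nlinarith
    · filter_upwards [hlim] with x hx
      exact hx.add ((hx.pow 2).const_mul 2)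
  have hL : ∀ᵐ ω ∂P, Tendsto (fun n => ENNReal.ofReal (Real.exp
      (∫ x in Ioc 0 T, h n x ∂(pathMeasure (fun r => S r ω))))) atTop
      (𝓝 (ENNReal.ofReal (Real.exp
      (∫ x in Ioc 0 T, g x ∂(pathMeasure (fun r => S r ω)))))) := by
    filter_upwards [hS.paths, hS.ae_ae_pathMeasure hlim] with ω hp hω
    have := isFiniteMeasure_pathMeasure_restrict hp.1 hp.2 0 T
    refine (ENNReal.continuous_ofReal.comp Real.continuous_exp).continuousAt.tendsto.comp ?_
    exact tendsto_integral_of_dominated_convergence (fun _ => 1 / 2)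
      (fun n => (hm n).aestronglyMeasurable) (integrable_const _)
      (fun n => ae_of_all _ fun x => hb n x) hω
  unfold ExpBound
  calc _ = ∫⁻ ω, liminf (fun n => ENNReal.ofReal (Real.exp
      (∫ x in Ioc 0 T, h n x ∂(pathMeasure (fun r => S r ω))))) atTop ∂P :=
        lintegral_congr_ae (hL.mono fun ω hω => hω.liminf_eq.symm)
    _ ≤ liminf (fun n => ∫⁻ ω, ENNReal.ofReal (Real.exp
      (∫ x in Ioc 0 T, h n x ∂(pathMeasure (fun r => S r ω)))) ∂P) atTop :=
        lintegral_liminf_le' hmeas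
    _ ≤ liminf (fun n => ENNReal.ofReal (Real.exp
      (∫ x in Ioc 0 T, (h n x + 2 * h n x ^ 2)))) atTop :=
        liminf_le_liminf (Eventually.of_forall hE)
    _ = _ := ((ENNReal.continuous_ofReal.comp
        Real.continuous_exp).continuousAt.tendsto.comp hR).liminf_eq

end IsGammaProcess

/-- On each cell (k/m, (k+1)/m] the function ⌈mx⌉/m is the right endpoint. Stated for a general μ so
that it serves both Lebesgue measure and the path measures. -/
lemma integral_ceil_eq_sum (μ : Measure ℝ) (g : ℝ → ℝ) {m : ℕ} (hm : 0 < m) (N : ℕ)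
    (hμ : ∀ a b, μ (Ioc a b) ≠ ∞) :
    ∫ x in Ioc 0 (N : ℝ), g (⌈(m : ℝ) * x⌉ / m) ∂μ
      = ∑ k ∈ Finset.range (N * m),
        g (((k + 1 : ℕ) : ℝ) / m) * μ.real (Ioc ((k : ℝ) / m) (((k + 1 : ℕ) : ℝ) / m)) := by
  have hm' : (0 : ℝ) < m := by exact_mod_cast hm
  have hle : ∀ k : ℕ, (k : ℝ) / m ≤ ((k + 1 : ℕ) : ℝ) / m := fun k => by
    gcongr; exact_mod_cast k.le_succ
  have hcell : ∀ k : ℕ, ∀ x ∈ Ioc ((k : ℝ) / m) (((k + 1 : ℕ) : ℝ) / m),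
      g (⌈(m : ℝ) * x⌉ / m) = g (((k + 1 : ℕ) : ℝ) / m) := by
    intro k x hx
    have h : ⌈(m : ℝ) * x⌉ = ((k + 1 : ℕ) : ℤ) := by
      rw [Int.ceil_eq_iff]
      rw [mem_Ioc, div_lt_iff₀ hm', le_div_iff₀ hm'] at hx
      push_cast at hx ⊢
      constructor <;> linarith [hx.1, hx.2]
    rw [h, Int.cast_natCast]
  have hsum := intervalIntegral.sum_integral_adjacent_intervals (μ := μ)
    (f := fun x => g (⌈(m : ℝ) * x⌉ / m)) (a := fun k : ℕ => (k : ℝ) / m) (n := N * m)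
    (fun k _ => by
      rw [intervalIntegrable_iff_integrableOn_Ioc_of_le (hle k)]
      exact (integrableOn_const (hμ _ _)).congr_fun (fun x hx => (hcell k x hx).symm)
        measurableSet_Ioc)
  have hN : ((N * m : ℕ) : ℝ) / m = N := by push_cast; field_simp
  simp only [Nat.cast_zero, zero_div, hN] at hsum
  rw [← intervalIntegral.integral_of_le (by positivity), ← hsum]
  refine Finset.sum_congr rfl fun k _ => ?_
  rw [intervalIntegral.integral_of_le (hle k), setIntegral_congr_fun measurableSet_Ioc (hcell k),
    setIntegral_const, smul_eq_mul, mul_comm]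

namespace IsGammaProcess

variable {Ω : Type*} [MeasurableSpace Ω] {P : Measure Ω} {S : ℝ≥0 → Ω → ℝ}

lemma expBound_ceil (hS : IsGammaProcess S P) {g : ℝ → ℝ} (hb : ∀ x, |g x| ≤ 1 / 2)
    {m : ℕ} (hm : 0 < m) (N : ℕ) : ExpBound S P N (fun x => g (⌈(m : ℝ) * x⌉ / m)) := by
  have hm' : (0 : ℝ≥0) < m := by exact_mod_cast hm
  let t : ℕ → ℝ≥0 := fun k => (k : ℝ≥0) / m
  have ht : StrictMono t := fun i j hij => by
    simp only [t]; gcongr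
  have htc : ∀ k : ℕ, (k : ℝ) / m = t k := fun k => by simp [t]
  have h := hS.lintegral_exp_sum_le ht (N * m) (c := fun k => g (((k + 1 : ℕ) : ℝ) / m))
    (fun k => hb _)
  unfold ExpBound
  have hR := integral_ceil_eq_sum volume (fun x => g x + 2 * g x ^ 2) hm N (by simp)
  rw [hR]
  refine (le_of_eq (lintegral_congr_ae ?_)).trans (h.trans (le_of_eq ?_))
  · filter_upwards [hS.paths] with ω hω
    rw [integral_ceil_eq_sum _ g hm N fun a b => by
      rw [pathMeasure_Ioc hω.1 hω.2]; exact ENNReal.ofReal_ne_top]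
    congr 2
    refine Finset.sum_congr rfl fun k _ => ?_
    rw [measureReal_def, pathMeasure_Ioc hω.1 hω.2, htc, htc, Real.toNNReal_coe, Real.toNNReal_coe,
      ENNReal.toReal_ofReal (sub_nonneg.2 (hω.1 (ht.monotone k.le_succ)))]
  · congr 2
    refine Finset.sum_congr rfl fun k _ => ?_
    rw [Real.volume_real_Ioc_of_le (by rw [htc, htc]; exact_mod_cast ht.monotone k.le_succ),
      htc, htc]

lemma expBound_of_continuous (hS : IsGammaProcess S P) {g : ℝ → ℝ} (hg : Continuous g)
    (hb : ∀ x, |g x| ≤ 1 / 2) (N : ℕ) : ExpBound S P N g := by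
  refine hS.expBound_of_tendsto (h := fun n x => g (⌈((n + 1 : ℕ) : ℝ) * x⌉ / (n + 1 : ℕ)))
    (fun n => hg.measurable.comp (by fun_prop)) (fun n x => hb _)
    (fun n => hS.expBound_ceil hb n.succ_pos N) (ae_of_all _ fun x => ?_)
  refine (hg.tendsto x).comp ?_
  have hlim : Tendsto (fun n : ℕ => x + 1 / ((n : ℝ) + 1)) atTop (𝓝 x) := by
    simpa using (tendsto_const_nhds (x := x)).add
      (tendsto_one_div_add_atTop_nhds_zero_nat (𝕜 := ℝ))
  refine tendsto_of_tendsto_of_tendsto_of_le_of_le tendsto_const_nhds hlim (fun n => ?_)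
    (fun n => ?_)
  · have : (0 : ℝ) < (n + 1 : ℕ) := by positivity
    simp only
    rw [le_div_iff₀ this, mul_comm]
    exact Int.le_ceil _
  · have : (0 : ℝ) < (n + 1 : ℕ) := by positivity
    simp only
    rw [div_le_iff₀ this]
    have h := (Int.ceil_lt_add_one (((n + 1 : ℕ) : ℝ) * x)).le
    refine h.trans (le_of_eq ?_)
    push_cast
    field_simp

/-- The exponential bound for bounded measurable functions. -/
lemma expBound (hS : IsGammaProcess S P) {g : ℝ → ℝ} (hg : Measurable g)
    (hb : ∀ x, |g x| ≤ 1 / 2) (N : ℕ) : ExpBound S P N g := by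
  have hint : Integrable g (volume.restrict (Ioc 0 (N : ℝ))) :=
    Integrable.of_bound hg.aestronglyMeasurable (1 / 2) (ae_of_all _ fun x => hb x)
  have hmem := memLp_one_iff_integrable.2 hint
  have hex : ∀ n : ℕ, _ := fun n => hmem.exists_boundedContinuous_eLpNorm_sub_le ENNReal.one_ne_top
    (ε := ((n : ℝ≥0∞) + 1)⁻¹) (by simp)
  choose u hu _ using hex
  have htend : Tendsto (fun n => eLpNorm ((u n : ℝ → ℝ) - g) 1 (volume.restrict (Ioc 0 (N : ℝ))))
      atTop (𝓝 0) := by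
    have h0 : Tendsto (fun n : ℕ => ((n : ℝ≥0∞) + 1)⁻¹) atTop (𝓝 0) := by
      have := (tendsto_add_atTop_iff_nat 1).2 ENNReal.tendsto_inv_nat_nhds_zero
      simpa using this
    refine tendsto_of_tendsto_of_tendsto_of_le_of_le tendsto_const_nhds h0 (fun _ => zero_le)
      fun n => ?_
    rw [eLpNorm_sub_comm]
    exact hu n
  obtain ⟨ns, -, hns⟩ := (tendstoInMeasure_of_tendsto_eLpNorm one_ne_zero
    (fun n => (u n).continuous.aestronglyMeasurable) hg.aestronglyMeasurable
    htend).exists_seq_tendsto_ae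
  -- The continuous L¹ approximants need not be bounded by 1/2. Clamping restores the bound and does
  -- not affect the limit g, which already satisfies it.
  let cl : ℝ → ℝ := fun y => max (-(1 / 2)) (min (1 / 2) y)
  have hcl : Continuous cl := by fun_prop
  have hclb : ∀ y, |cl y| ≤ 1 / 2 := fun y =>
    abs_le.2 ⟨le_max_left _ _, max_le (by norm_num) (min_le_left _ _)⟩
  have hclg : ∀ x, cl (g x) = g x := fun x => by
    have := abs_le.1 (hb x)
    simp only [cl]
    rw [min_eq_right this.2, max_eq_right this.1]
  refine hS.expBound_of_tendsto (h := fun n x => cl (u (ns n) x))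
    (fun n => (hcl.comp (u (ns n)).continuous).measurable) (fun n x => hclb _)
    (fun n => hS.expBound_of_continuous (hcl.comp (u (ns n)).continuous) (fun x => hclb _) N) ?_
  filter_upwards [hns] with x hx
  have := (hcl.tendsto (g x)).comp hx
  rwa [hclg] at this

end IsGammaProcess

/-! ### L^p bounds for integrals against dS. -/

lemma exists_abs_rpow_le_cosh {p : ℝ} (hp : 2 ≤ p) :
    ∃ K : ℝ, 0 ≤ K ∧ ∀ y : ℝ, |y| ^ p ≤ K * (Real.exp y + Real.exp (-y) - 2) := by
  obtain ⟨k, hk⟩ := exists_nat_ge p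
  have hterm : ∀ (j : ℕ) (y : ℝ), 0 < j → y ^ (2 * j) / (2 * j).factorial ≤ Real.cosh y - 1 := by
    intro j y hj
    have h := (Real.hasSum_cosh y).summable.sum_le_tsum {0, j} fun i _ => by
      have : 0 ≤ y ^ (2 * i) := by rw [pow_mul]; positivity
      positivity
    rw [← Real.cosh_eq_tsum, Finset.sum_pair hj.ne] at h
    simp only [mul_zero, pow_zero, Nat.factorial_zero, Nat.cast_one, div_one] at h
    linarith
  have hk0 : 0 < k := by
    rcases Nat.eq_zero_or_pos k with rfl | h
    · simp at hk; linarith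
    · exact h
  -- `|y|^p ≤ y² + y^{2k}`, using p ≥ 2 when |y| ≤ 1 and p ≤ 2k otherwise. Each power is a multiple,
  -- 2! or (2k)!, of one term of the series for `cosh y - 1 = (e^y + e^{-y} - 2) / 2`.
  refine ⟨(2 + (2 * k).factorial) / 2, by positivity, fun y => ?_⟩
  have h1 := hterm 1 y one_pos
  have h2 := hterm k y hk0
  rw [div_le_iff₀ (by positivity)] at h1 h2
  simp only [mul_one, Nat.factorial_two, Nat.cast_ofNat] at h1
  have h3 : |y| ^ p ≤ y ^ 2 + y ^ (2 * k) := by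
    rcases le_or_gt |y| 1 with hy | hy
    · have : |y| ^ p ≤ |y| ^ (2 : ℝ) := Real.rpow_le_rpow_of_exponent_ge' (abs_nonneg y) hy
        (by norm_num) hp
      rw [Real.rpow_two, sq_abs] at this
      have : 0 ≤ y ^ (2 * k) := by rw [pow_mul]; positivity
      linarith
    · have h : |y| ^ p ≤ |y| ^ ((2 * k : ℕ) : ℝ) := Real.rpow_le_rpow_of_exponent_le hy.le
        (by push_cast; linarith)
      rw [Real.rpow_natCast, pow_mul, sq_abs, ← pow_mul] at h
      nlinarith [sq_nonneg y]
  rw [Real.cosh_eq] at h1 h2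
  nlinarith

namespace IsGammaProcess

variable {Ω : Type*} [MeasurableSpace Ω] {P : Measure Ω} {S : ℝ≥0 → Ω → ℝ}

lemma lintegral_exp_sub_le (hS : IsGammaProcess S P) {g : ℝ → ℝ} (hg : Measurable g)
    (hb : ∀ x, |g x| ≤ 1 / 2) (N : ℕ) :
    ∫⁻ ω, ENNReal.ofReal (Real.exp ((∫ x in Ioc 0 (N : ℝ), g x ∂(pathMeasure (fun r => S r ω)))
        - ∫ x in Ioc 0 (N : ℝ), g x)) ∂P
      ≤ ENNReal.ofReal (Real.exp (2 * ∫ x in Ioc 0 (N : ℝ), g x ^ 2)) := by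
  have hint : IntegrableOn g (Ioc 0 (N : ℝ)) :=
    Integrable.of_bound hg.aestronglyMeasurable (1 / 2) (ae_of_all _ fun x => hb x)
  have hint2 : IntegrableOn (fun x => g x ^ 2) (Ioc 0 (N : ℝ)) :=
    Integrable.of_bound (hg.pow_const 2).aestronglyMeasurable 1 (ae_of_all _ fun x => by
      have := abs_le.1 (hb x)
      rw [Real.norm_eq_abs, abs_le]; constructor <;> nlinarith)
  have h := hS.expBound hg hb N
  unfold ExpBound at h
  rw [integral_add hint (hint2.const_mul 2), integral_const_mul, Real.exp_add] at h
  simp_rw [sub_eq_add_neg, Real.exp_add, ENNReal.ofReal_mul (Real.exp_pos _).le]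
  rw [lintegral_mul_const' _ _ ENNReal.ofReal_ne_top]
  calc _ ≤ ENNReal.ofReal (Real.exp (∫ x in Ioc 0 (N : ℝ), g x) *
        Real.exp (2 * ∫ x in Ioc 0 (N : ℝ), g x ^ 2)) *
        ENNReal.ofReal (Real.exp (-∫ x in Ioc 0 (N : ℝ), g x)) := by gcongr
    _ = _ := by
      rw [← ENNReal.ofReal_mul (by positivity), ← Real.exp_add, ← Real.exp_add]
      congr 2; ring

/-- The exponential bound is the same for g and -g. Adding the two and subtracting 2 leaves a
quantity that vanishes with `∫ g²`, which a one-sided exponential bound would not give. -/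
lemma lintegral_abs_rpow_le [IsProbabilityMeasure P] (hS : IsGammaProcess S P) {p K : ℝ}
    (hK : 0 ≤ K) (hpK : ∀ y : ℝ, |y| ^ p ≤ K * (Real.exp y + Real.exp (-y) - 2))
    {g : ℝ → ℝ} (hg : Measurable g) (hb : ∀ x, |g x| ≤ 1 / 2) (N : ℕ) :
    ∫⁻ ω, ENNReal.ofReal (|(∫ x in Ioc 0 (N : ℝ), g x ∂(pathMeasure (fun r => S r ω)))
        - ∫ x in Ioc 0 (N : ℝ), g x| ^ p) ∂P
      ≤ ENNReal.ofReal (K * (2 * (Real.exp (2 * ∫ x in Ioc 0 (N : ℝ), g x ^ 2) - 1))) := by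
  have hint : IntegrableOn g (Ioc 0 (N : ℝ)) :=
    Integrable.of_bound hg.aestronglyMeasurable (1 / 2) (ae_of_all _ fun x => hb x)
  set Y : Ω → ℝ := fun ω => (∫ x in Ioc 0 (N : ℝ), g x ∂(pathMeasure (fun r => S r ω)))
        - ∫ x in Ioc 0 (N : ℝ), g x with hY
  have hYm : AEMeasurable Y P := (hS.aemeasurable_integral_pathMeasure hg hint).sub_const _
  have h1 := hS.lintegral_exp_sub_le hg hb N
  have h2 := hS.lintegral_exp_sub_le (g := fun x => -g x) hg.neg (fun x => by simpa using hb x) N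
  have e2 : ∀ ω, (∫ x in Ioc 0 (N : ℝ), -g x ∂(pathMeasure (fun r => S r ω)))
        - ∫ x in Ioc 0 (N : ℝ), -g x = -Y ω := fun ω => by
    rw [integral_neg, integral_neg, hY]; ring
  simp_rw [e2, neg_sq] at h2
  set E := Real.exp (2 * ∫ x in Ioc 0 (N : ℝ), g x ^ 2)
  have hnn : ∀ y : ℝ, 0 ≤ Real.exp y + Real.exp (-y) - 2 := fun y => by
    have := Real.one_le_cosh y
    rw [Real.cosh_eq] at this
    linarith
  have h3 : ∫⁻ ω, ENNReal.ofReal (Real.exp (Y ω) + Real.exp (-Y ω) - 2) ∂P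
      ≤ ENNReal.ofReal (2 * (E - 1)) := by
    have h4 : ∫⁻ ω, ENNReal.ofReal (Real.exp (Y ω) + Real.exp (-Y ω) - 2) ∂P + ENNReal.ofReal 2
        ≤ ENNReal.ofReal E + ENNReal.ofReal E := by
      have : ENNReal.ofReal 2 = ∫⁻ _, ENNReal.ofReal 2 ∂P := by simp
      rw [this, ← lintegral_add_right _ measurable_const]
      simp_rw [← ENNReal.ofReal_add (hnn _) zero_le_two, sub_add_cancel,
        ENNReal.ofReal_add (Real.exp_pos _).le (Real.exp_pos _).le]
      rw [lintegral_add_left' hYm.exp.ennreal_ofReal]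
      exact add_le_add h1 h2
    have h5 := ENNReal.le_sub_of_add_le_right ENNReal.ofReal_ne_top h4
    rw [← ENNReal.ofReal_add (Real.exp_pos _).le (Real.exp_pos _).le,
      ← ENNReal.ofReal_sub _ zero_le_two] at h5
    convert h5 using 2
    ring
  calc _ ≤ ∫⁻ ω, ENNReal.ofReal (K * (Real.exp (Y ω) + Real.exp (-Y ω) - 2)) ∂P :=
        lintegral_mono fun ω => ENNReal.ofReal_le_ofReal (hpK _)
    _ = ENNReal.ofReal K * ∫⁻ ω, ENNReal.ofReal (Real.exp (Y ω) + Real.exp (-Y ω) - 2) ∂P := by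
        simp_rw [ENNReal.ofReal_mul hK]
        rw [lintegral_const_mul' _ _ ENNReal.ofReal_ne_top]
    _ ≤ ENNReal.ofReal K * ENNReal.ofReal (2 * (E - 1)) := by gcongr
    _ = _ := (ENNReal.ofReal_mul hK).symm

lemma eLpNorm_integral_sub_le [IsProbabilityMeasure P] (hS : IsGammaProcess S P) {p K : ℝ}
    (hp : 0 < p) (hK : 0 ≤ K)
    (hpK : ∀ y : ℝ, |y| ^ p ≤ K * (Real.exp y + Real.exp (-y) - 2))
    {g : ℝ → ℝ} (hg : Measurable g) (hb : ∀ x, |g x| ≤ 1 / 2) (N : ℕ) :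
    eLpNorm (fun ω => (∫ x in Ioc 0 (N : ℝ), g x ∂(pathMeasure (fun r => S r ω)))
        - ∫ x in Ioc 0 (N : ℝ), g x) (ENNReal.ofReal p) P
      ≤ ENNReal.ofReal (K * (2 * (Real.exp (2 * ∫ x in Ioc 0 (N : ℝ), g x ^ 2) - 1)))
        ^ (1 / p) := by
  rw [eLpNorm_eq_lintegral_rpow_enorm_toReal (by simpa using hp) ENNReal.ofReal_ne_top,
    ENNReal.toReal_ofReal hp.le]
  refine ENNReal.rpow_le_rpow ?_ (by positivity)
  refine le_trans (le_of_eq (lintegral_congr fun ω => ?_)) (hS.lintegral_abs_rpow_le hK hpK hg hb N)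
  rw [Real.enorm_eq_ofReal_abs, ENNReal.ofReal_rpow_of_nonneg (abs_nonneg _) hp.le]

/-- `L^p`-integrability on a bounded interval passes to the integral against the process. -/
lemma memLp_gammaIntegral [IsProbabilityMeasure P] (hS : IsGammaProcess S P) {p : ℝ} (hp : 1 ≤ p)
    {f : ℝ → ℝ} (hf : Measurable f) {T : ℝ≥0}
    (hfp : MemLp f (ENNReal.ofReal p) (volume.restrict (Ioc 0 (T : ℝ)))) :
    MemLp (gammaIntegral S f T) (ENNReal.ofReal p) P := by
  have hp0 : 0 < p := by linarith
  have hp1 : (1 : ℝ≥0∞) ≤ ENNReal.ofReal p := ENNReal.one_le_ofReal.2 hp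
  have hint : IntegrableOn f (Ioc 0 (T : ℝ)) := hfp.integrable hp1
  refine ⟨(hS.aemeasurable_integral_pathMeasure hf hint).aestronglyMeasurable, ?_⟩
  rw [eLpNorm_lt_top_iff_lintegral_rpow_enorm_lt_top (by simpa using hp0) ENNReal.ofReal_ne_top,
    ENNReal.toReal_ofReal hp0.le]
  have hfin := (eLpNorm_lt_top_iff_lintegral_rpow_enorm_lt_top (by simpa using hp0)
    ENNReal.ofReal_ne_top).1 hfp.2
  rw [ENNReal.toReal_ofReal hp0.le] at hfin
  have hm : Measurable fun x => ‖f x‖ₑ ^ p := by fun_prop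
  -- Hölder's inequality along each path gives `|∫ f dS|^p ≤ (total mass)^{p-1} ∫ |f|^p dS`. The
  -- mass is at most `S (T + 1)`, and the weighted moment formula makes the expectation finite.
  have hmain := hS.lintegral_rpow_mul_lintegral_pathMeasure T (sub_nonneg.2 hp) hm
  refine lt_of_le_of_lt ?_ (lt_of_le_of_lt hmain.le (ENNReal.mul_lt_top
    (hS.lintegral_rpow_lt_top (t := T + 2) (by positivity) (sub_nonneg.2 hp)) hfin))
  refine lintegral_mono_ae ?_
  filter_upwards [hS.paths, hS.zero] with ω hω h0
  set μ := (pathMeasure (fun r => S r ω)).restrict (Ioc 0 (T : ℝ)) with hμ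
  have hμu : μ univ ≤ ENNReal.ofReal (S (T + 1) ω) := by
    rw [hμ, Measure.restrict_apply_univ, pathMeasure_Ioc hω.1 hω.2, Real.toNNReal_coe,
      Real.toNNReal_zero, h0, sub_zero]
    exact ENNReal.ofReal_le_ofReal (hω.1 (by simp))
  have hS0 : 0 ≤ S (T + 1) ω := by rw [← h0]; exact hω.1 (zero_le (a := T + 1))
  have hhold := eLpNorm_le_eLpNorm_mul_rpow_measure_univ (μ := μ) hp1 hf.aestronglyMeasurable
  rw [eLpNorm_one_eq_lintegral_enorm, eLpNorm_eq_lintegral_rpow_enorm_toReal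
    (by simpa using hp0) ENNReal.ofReal_ne_top, ENNReal.toReal_ofReal hp0.le,
    ENNReal.toReal_one] at hhold
  calc ‖gammaIntegral S f T ω‖ₑ ^ p ≤ (∫⁻ x, ‖f x‖ₑ ∂μ) ^ p := by
        gcongr
        exact enorm_integral_le_lintegral_enorm _
    _ ≤ ((∫⁻ x, ‖f x‖ₑ ^ p ∂μ) ^ (1 / p) * μ univ ^ (1 / 1 - 1 / p)) ^ p := by gcongr
    _ = μ univ ^ (p - 1) * ∫⁻ x, ‖f x‖ₑ ^ p ∂μ := by
        rw [ENNReal.mul_rpow_of_nonneg _ _ hp0.le, ← ENNReal.rpow_mul, ← ENNReal.rpow_mul,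
          one_div_mul_cancel hp0.ne', ENNReal.rpow_one, mul_comm]
        congr 2
        field_simp
    _ ≤ _ := by
        rw [← ENNReal.ofReal_rpow_of_nonneg hS0 (sub_nonneg.2 hp)]
        gcongr

/-! ### The variance identity and part (a). -/

/-- The variance of `∫₀ᵗ f dS`. -/
lemma lintegral_enorm_gammaIntegral_sub_sq [IsProbabilityMeasure P] (hS : IsGammaProcess S P)
    {f : ℝ → ℝ} (hfm : Measurable f) (hf : ∀ x, 0 ≤ x → 0 ≤ f x) {t : ℝ}
    (hi : IntegrableOn f (Ioc 0 t)) :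
    ∫⁻ ω, ‖gammaIntegral S f t ω - lam f t‖ₑ ^ 2 ∂P
      = ∫⁻ x in Ioc 0 t, ENNReal.ofReal (f x ^ 2) := by
  have hφ : Measurable fun x => ENNReal.ofReal (f x) := hfm.ennreal_ofReal
  have hnn : ∀ μ : Measure ℝ, 0 ≤ᵐ[μ.restrict (Ioc 0 t)] f := fun μ =>
    (ae_restrict_iff' measurableSet_Ioc).2 (ae_of_all _ fun x hx => hf x hx.1.le)
  have hl0 : 0 ≤ lam f t := integral_nonneg_of_ae (hnn _)
  have hlam : ∫⁻ x in Ioc 0 t, ENNReal.ofReal (f x) = ENNReal.ofReal (lam f t) :=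
    (ofReal_integral_eq_lintegral_ofReal hi (hnn _)).symm
  have hG0 : ∀ ω, 0 ≤ gammaIntegral S f t ω := fun ω => integral_nonneg_of_ae (hnn _)
  have hG : ∀ᵐ ω ∂P, ∫⁻ x in Ioc 0 t, ENNReal.ofReal (f x) ∂(pathMeasure (fun r => S r ω))
      = ENNReal.ofReal (gammaIntegral S f t ω) := by
    filter_upwards [hS.ae_integrableOn_pathMeasure hfm hi] with ω hω
    exact (ofReal_integral_eq_lintegral_ofReal hω (hnn _)).symm
  have hGm : AEMeasurable (gammaIntegral S f t) P := hS.aemeasurable_integral_pathMeasure hfm hi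
  have h1 := hS.lintegral_lintegral_pathMeasure t hφ
  have h2 := hS.lintegral_sq_lintegral_pathMeasure hφ (hlam ▸ ENNReal.ofReal_ne_top)
  rw [lintegral_congr_ae hG, hlam] at h1
  rw [lintegral_congr_ae (hG.mono fun ω h => by simp only [h]; rfl), hlam] at h2
  have hsq : ∫⁻ x in Ioc 0 t, ENNReal.ofReal (f x) ^ 2
      = ∫⁻ x in Ioc 0 t, ENNReal.ofReal (f x ^ 2) :=
    setLIntegral_congr_fun measurableSet_Ioc fun x hx =>
      (ENNReal.ofReal_pow (hf x hx.1.le) 2).symm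
  rw [hsq] at h2
  set l := lam f t
  -- With G the integral, `(G - l)² + 2 l G = G² + l²` and `E G = l`. Moving the cross term to the
  -- left avoids subtraction, so the identity also covers `∫ f² = ∞`; only the finite `2 l²` is
  -- cancelled.
  have key : ∫⁻ ω, ‖gammaIntegral S f t ω - l‖ₑ ^ 2 ∂P + ENNReal.ofReal (2 * l ^ 2)
      = (∫⁻ x in Ioc 0 t, ENNReal.ofReal (f x ^ 2)) + ENNReal.ofReal (2 * l ^ 2) := by
    have e1 : ENNReal.ofReal (2 * l ^ 2)
        = ∫⁻ ω, ENNReal.ofReal (2 * l) * ENNReal.ofReal (gammaIntegral S f t ω) ∂P := by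
      rw [lintegral_const_mul' _ _ ENNReal.ofReal_ne_top, h1, ← ENNReal.ofReal_mul (by positivity)]
      congr 1; ring
    conv_lhs => rw [e1]
    rw [← lintegral_add_left' ((hGm.sub_const l).enorm.pow_const 2)]
    have e2 : ∀ ω, ‖gammaIntegral S f t ω - l‖ₑ ^ 2
        + ENNReal.ofReal (2 * l) * ENNReal.ofReal (gammaIntegral S f t ω)
        = ENNReal.ofReal (gammaIntegral S f t ω) ^ 2 + ENNReal.ofReal (l ^ 2) := by
      intro ω
      have := hG0 ω
      rw [Real.enorm_eq_ofReal_abs, ← ENNReal.ofReal_pow (abs_nonneg _), sq_abs,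
        ← ENNReal.ofReal_mul (by positivity), ← ENNReal.ofReal_add (by positivity) (by positivity),
        ← ENNReal.ofReal_pow this, ← ENNReal.ofReal_add (by positivity) (by positivity)]
      congr 1; ring
    simp_rw [e2]
    rw [lintegral_add_right _ measurable_const, h2, lintegral_const, measure_univ, mul_one,
      ← ENNReal.ofReal_pow hl0, add_right_comm, ← ENNReal.ofReal_add (by positivity) (by positivity),
      add_comm]
    congr 2; ring
  exact (ENNReal.add_left_inj ENNReal.ofReal_ne_top).1 key

lemma eLpNorm_R_sub_one [IsProbabilityMeasure P] (hS : IsGammaProcess S P)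
    {f : ℝ → ℝ} (hfm : Measurable f) (hf : ∀ x, 0 ≤ x → 0 ≤ f x) {t : ℝ}
    (hi : IntegrableOn f (Ioc 0 t)) (hl : 0 < lam f t) :
    eLpNorm (fun ω => R S f t ω - 1) (ENNReal.ofReal 2) P = v f t ^ (1 / 2 : ℝ) := by
  rw [eLpNorm_eq_lintegral_rpow_enorm_toReal (by simp) ENNReal.ofReal_ne_top,
    ENNReal.toReal_ofReal zero_le_two]
  congr 1
  rw [v, ← hS.lintegral_enorm_gammaIntegral_sub_sq hfm hf hi, ENNReal.div_eq_inv_mul,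
    ← lintegral_const_mul' _ _ (by simpa using by positivity)]
  refine lintegral_congr fun ω => ?_
  rw [← ENNReal.ofReal_inv_of_pos (by positivity), Real.enorm_eq_ofReal_abs,
    Real.enorm_eq_ofReal_abs, ← ENNReal.ofReal_pow (abs_nonneg _), sq_abs,
    ← ENNReal.ofReal_mul (by positivity), ENNReal.rpow_ofNat, ← ENNReal.ofReal_pow (abs_nonneg _),
    sq_abs, R]
  congr 1
  field_simp

lemma aemeasurable_R (hS : IsGammaProcess S P) {f : ℝ → ℝ} (hfm : Measurable f) {t : ℝ}
    (hi : IntegrableOn f (Ioc 0 t)) : AEMeasurable (R S f t) P :=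
  (hS.aemeasurable_integral_pathMeasure hfm hi).div_const _

lemma odLp_two_iff [IsProbabilityMeasure P] (hS : IsGammaProcess S P)
    {f : ℝ → ℝ} (hfm : Measurable f) (hf : ∀ x, 0 ≤ x → 0 ≤ f x)
    (hloc : ∀ t, IntegrableOn f (Ioc 0 t)) (hdiv : Tendsto (lam f) atTop atTop) :
    ODLp S P f 2 ↔ Tendsto (v f) atTop (𝓝 0) := by
  have hev : ∀ᶠ t in atTop, eLpNorm (fun ω => R S f t ω - 1) (ENNReal.ofReal 2) P
      = v f t ^ (1 / 2 : ℝ) := by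
    filter_upwards [hdiv.eventually_gt_atTop 0] with t ht
    exact hS.eLpNorm_R_sub_one hfm hf (hloc t) ht
  constructor
  · rintro ⟨-, h⟩
    have h2 := (h.congr' hev).ennrpow_const 2
    rw [ENNReal.zero_rpow_of_pos two_pos] at h2
    refine h2.congr fun t => ?_
    rw [← ENNReal.rpow_mul]; norm_num
  · intro h
    have h2 := h.ennrpow_const (1 / 2)
    rw [ENNReal.zero_rpow_of_pos (by norm_num)] at h2
    refine ⟨?_, h2.congr' (hev.mono fun _ h => h.symm)⟩
    filter_upwards [hev, h.eventually (gt_mem_nhds ENNReal.zero_lt_top)] with t ht hv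
    have hm : MemLp (fun ω => R S f t ω - 1) (ENNReal.ofReal 2) P :=
      ⟨((hS.aemeasurable_R hfm (hloc t)).sub_const 1).aestronglyMeasurable, by
        rw [ht]; exact ENNReal.rpow_lt_top_of_nonneg (by norm_num) hv.ne⟩
    have := hm.add (memLp_const (1 : ℝ))
    refine this.ae_eq (ae_of_all _ fun ω => ?_)
    simp

end IsGammaProcess

/-! ### Splitting off the tail of f, and part (b). -/

lemma setIntegral_indicator_const_mul (μ : Measure ℝ) (f : ℝ → ℝ) (c : ℝ) {a t u : ℝ}
    (ha : 0 ≤ a) (htu : t ≤ u) :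
    ∫ x in Ioc 0 u, (Ioc a t).indicator (fun x => c * f x) x ∂μ = c * ∫ x in Ioc a t, f x ∂μ := by
  rw [setIntegral_indicator measurableSet_Ioc, inter_eq_right.2 (Ioc_subset_Ioc ha htu),
    integral_const_mul]

lemma setIntegral_Ioc_add {μ : Measure ℝ} {f : ℝ → ℝ} {a t : ℝ} (ha : 0 ≤ a) (hat : a ≤ t)
    (hi : IntegrableOn f (Ioc 0 t) μ) :
    ∫ x in Ioc 0 t, f x ∂μ = (∫ x in Ioc 0 a, f x ∂μ) + ∫ x in Ioc a t, f x ∂μ := by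
  rw [← Ioc_union_Ioc_eq_Ioc ha hat]
  exact setIntegral_union (Ioc_disjoint_Ioc_of_le le_rfl) measurableSet_Ioc
    (hi.mono_set (Ioc_subset_Ioc_right hat)) (hi.mono_set (Ioc_subset_Ioc_left ha))

lemma lam_mono {f : ℝ → ℝ} (hf : ∀ x, 0 ≤ x → 0 ≤ f x) (hloc : ∀ t, IntegrableOn f (Ioc 0 t)) :
    Monotone (lam f) := fun _ t hst =>
  setIntegral_mono_set (hloc t) ((ae_restrict_iff' measurableSet_Ioc).2
    (ae_of_all _ fun x hx => hf x hx.1.le)) (Ioc_subset_Ioc_right hst).eventuallyLE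

/-- The part of `f` on `(a, t]`, normalized by `c * λ_t f`. -/
noncomputable def normalizedTail (f : ℝ → ℝ) (a c t : ℝ) : ℝ → ℝ :=
  (Ioc a t).indicator fun x => c / lam f t * f x

lemma measurable_normalizedTail {f : ℝ → ℝ} (hfm : Measurable f) (a c t : ℝ) :
    Measurable (normalizedTail f a c t) :=
  (hfm.const_mul _).indicator measurableSet_Ioc

/-- If `f ≤ C λ f` on `[a, ∞)`, the tail normalized by `2 C λ_t f` is bounded by `1 / 2`. -/
lemma abs_normalizedTail_le {f : ℝ → ℝ} (hf : ∀ x, 0 ≤ x → 0 ≤ f x)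
    (hloc : ∀ t, IntegrableOn f (Ioc 0 t)) {a C : ℝ} (ha : 0 ≤ a) (hC : 0 < C)
    (hpos : ∀ t, a ≤ t → 0 < lam f t) (hb : ∀ t, a ≤ t → b f t ≤ C) (t x : ℝ) :
    |normalizedTail f a (1 / (2 * C)) t x| ≤ 1 / 2 := by
  by_cases hx : x ∈ Ioc a t
  · have hx0 := hpos x hx.1.le
    have ht0 := hpos t (hx.1.le.trans hx.2)
    have h1 := hb x hx.1.le
    rw [b, div_le_iff₀ hx0] at h1
    have h2 : f x ≤ C * lam f t := h1.trans (by gcongr; exact lam_mono hf hloc hx.2)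
    have h3 := hf x (ha.trans hx.1.le)
    rw [normalizedTail, indicator_of_mem hx, abs_of_nonneg (by positivity)]
    calc 1 / (2 * C) / lam f t * f x ≤ 1 / (2 * C) / lam f t * (C * lam f t) := by gcongr
      _ = 1 / 2 := by field_simp
  · rw [normalizedTail, indicator_of_notMem hx]; norm_num

lemma ofReal_integral_normalizedTail_sq_le {f : ℝ → ℝ} (hfm : Measurable f) {a c t : ℝ}
    (ha : 0 ≤ a) (hc : |c| ≤ 1) (hpos : 0 < lam f t)
    (hb : ∀ x, |normalizedTail f a c t x| ≤ 1 / 2) (u : ℝ) :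
    ENNReal.ofReal (∫ x in Ioc 0 u, normalizedTail f a c t x ^ 2) ≤ v f t := by
  have hint : Integrable (fun x => normalizedTail f a c t x ^ 2) (volume.restrict (Ioc 0 u)) :=
    Integrable.of_bound ((measurable_normalizedTail hfm a c t).pow_const 2).aestronglyMeasurable 1
      (ae_of_all _ fun x => by
        have := abs_le.1 (hb x)
        rw [Real.norm_eq_abs, abs_le]; constructor <;> nlinarith)
  rw [ofReal_integral_eq_lintegral_ofReal hint (ae_of_all _ fun x => sq_nonneg _)]
  have hle : ∀ x, ENNReal.ofReal (normalizedTail f a c t x ^ 2)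
      ≤ (Ioc 0 t).indicator
        (fun x => (ENNReal.ofReal (lam f t ^ 2))⁻¹ * ENNReal.ofReal (f x ^ 2)) x := by
    intro x
    by_cases hx : x ∈ Ioc a t
    · rw [indicator_of_mem (Ioc_subset_Ioc_left ha hx), normalizedTail, indicator_of_mem hx,
        ← ENNReal.ofReal_inv_of_pos (by positivity), ← ENNReal.ofReal_mul (by positivity)]
      refine ENNReal.ofReal_le_ofReal ?_
      have hc2 : c ^ 2 ≤ 1 := (sq_le_one_iff_abs_le_one c).2 hc
      calc (c / lam f t * f x) ^ 2 = c ^ 2 * ((lam f t ^ 2)⁻¹ * f x ^ 2) := by field_simp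
        _ ≤ 1 * ((lam f t ^ 2)⁻¹ * f x ^ 2) := by gcongr
        _ = _ := one_mul _
    · rw [normalizedTail, indicator_of_notMem hx]; simp
  calc _ ≤ ∫⁻ x, (Ioc 0 t).indicator
        (fun x => (ENNReal.ofReal (lam f t ^ 2))⁻¹ * ENNReal.ofReal (f x ^ 2)) x :=
        (lintegral_mono hle).trans (setLIntegral_le_lintegral _ _)
    _ = v f t := by
        rw [lintegral_indicator measurableSet_Ioc, lintegral_const_mul _ (by fun_prop), v,
          ENNReal.div_eq_inv_mul]

namespace IsGammaProcess

variable {Ω : Type*} [MeasurableSpace Ω] {P : Measure Ω} {S : ℝ≥0 → Ω → ℝ}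

lemma R_sub_one_ae_eq (hS : IsGammaProcess S P) {f : ℝ → ℝ} (hfm : Measurable f)
    (hloc : ∀ t, IntegrableOn f (Ioc 0 t)) {a c t u : ℝ} (ha : 0 ≤ a) (hat : a ≤ t) (htu : t ≤ u)
    (hc : c ≠ 0) (hl : lam f t ≠ 0) :
    (fun ω => R S f t ω - 1) =ᵐ[P] (lam f t)⁻¹ • (fun ω => gammaIntegral S f a ω - lam f a)
      + c⁻¹ • (fun ω =>
        (∫ x in Ioc 0 u, normalizedTail f a c t x ∂(pathMeasure (fun r => S r ω)))
          - ∫ x in Ioc 0 u, normalizedTail f a c t x) := by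
  filter_upwards [hS.ae_integrableOn_pathMeasure hfm (hloc t)] with ω hω
  have h1 := setIntegral_Ioc_add ha hat hω
  have h2 : lam f t = lam f a + ∫ x in Ioc a t, f x := setIntegral_Ioc_add ha hat (hloc t)
  simp only [Pi.add_apply, Pi.smul_apply, smul_eq_mul, normalizedTail,
    setIntegral_indicator_const_mul _ _ _ ha htu]
  rw [show (∫ x in Ioc a t, f x) = lam f t - lam f a by rw [h2]; ring, R, gammaIntegral, h1,
    gammaIntegral]
  field_simp
  ring

lemma odLp_of_tendsto_v [IsProbabilityMeasure P] (hS : IsGammaProcess S P)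
    {f : ℝ → ℝ} (hfm : Measurable f) (hf : ∀ x, 0 ≤ x → 0 ≤ f x)
    (hloc : ∀ t, IntegrableOn f (Ioc 0 t)) (hdiv : Tendsto (lam f) atTop atTop)
    (hb : ∃ C t₀ : ℝ, ∀ t, t₀ ≤ t → b f t ≤ C) (hv : Tendsto (v f) atTop (𝓝 0))
    {p : ℝ} (hp : 2 ≤ p)
    (hfp : ∀ t, MemLp f (ENNReal.ofReal p) (volume.restrict (Ioc 0 t))) :
    ODLp S P f p := by
  obtain ⟨C₀, t₀, hC₀⟩ := hb
  obtain ⟨t₁, ht₁⟩ := eventually_atTop.1 (hdiv.eventually_gt_atTop 0)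
  obtain ⟨K, hK, hpK⟩ := exists_abs_rpow_le_cosh hp
  have hp0 : 0 < p := by linarith
  have hp1 : 1 ≤ p := by linarith
  have hmem : ∀ t : ℝ, 0 ≤ t → MemLp (gammaIntegral S f t) (ENNReal.ofReal p) P := fun t ht =>
    hS.memLp_gammaIntegral (T := ⟨t, ht⟩) hp1 hfm (hfp t)
  let a : ℝ := max (max t₀ t₁) 0
  -- Taking C ≥ 1 makes `c = 1 / (2C)` at most 1, so that the squared normalized tail integrates to
  -- at most `v_t`.
  let C : ℝ := max C₀ 1
  have ha : 0 ≤ a := le_max_right _ _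
  have hC : 1 ≤ C := le_max_right _ _
  have hC0 : 0 < C := by linarith
  have hpos : ∀ t, a ≤ t → 0 < lam f t := fun t ht =>
    ht₁ t (((le_max_right _ _).trans (le_max_left _ _)).trans ht)
  have hbC : ∀ t, a ≤ t → b f t ≤ C := fun t ht =>
    (hC₀ t (((le_max_left _ _).trans (le_max_left _ _)).trans ht)).trans (le_max_left _ _)
  set c : ℝ := 1 / (2 * C) with hc
  have hc0 : 0 < c := by positivity
  have hc1 : |c| ≤ 1 := by
    rw [abs_of_pos hc0, hc, div_le_one (by positivity)]; linarith
  have hg : ∀ t x, |normalizedTail f a c t x| ≤ 1 / 2 :=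
    abs_normalizedTail_le hf hloc ha hC0 hpos hbC
  have hgm : ∀ t, Measurable (normalizedTail f a c t) := fun t => measurable_normalizedTail hfm a c t
  -- The exponential bound is available on integer horizons. Passing from t to ⌈t⌉ costs nothing,
  -- since the normalized tail is zero beyond t.
  let w : ℝ → ℝ := fun t => ∫ x in Ioc 0 (⌈t⌉₊ : ℝ), normalizedTail f a c t x ^ 2
  have hw : Tendsto w atTop (𝓝 0) := by
    have h1 : Tendsto (fun t => ENNReal.ofReal (w t)) atTop (𝓝 0) := by
      refine tendsto_of_tendsto_of_tendsto_of_le_of_le' tendsto_const_nhds hv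
        (Eventually.of_forall fun _ => zero_le) ?_
      filter_upwards [eventually_ge_atTop a] with t ht
      exact ofReal_integral_normalizedTail_sq_le hfm ha hc1 (hpos t ht) (hg t) _
    have h2 := (ENNReal.tendsto_toReal ENNReal.zero_ne_top).comp h1
    refine h2.congr fun t => ENNReal.toReal_ofReal (integral_nonneg fun x => sq_nonneg _)
  let B : ℝ → ℝ≥0∞ := fun t =>
    ENNReal.ofReal (K * (2 * (Real.exp (2 * w t) - 1))) ^ (1 / p)
  have hB : Tendsto B atTop (𝓝 0) := by
    have hcont : Continuous fun y : ℝ => ENNReal.ofReal (K * (2 * (Real.exp (2 * y) - 1))) :=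
      ENNReal.continuous_ofReal.comp (by fun_prop)
    have h := ((hcont.tendsto 0).comp hw).ennrpow_const (1 / p)
    simp only [mul_zero, Real.exp_zero, sub_self, ENNReal.ofReal_zero] at h
    rwa [ENNReal.zero_rpow_of_pos (by positivity)] at h
  refine ⟨?_, ?_⟩
  · filter_upwards [eventually_ge_atTop 0] with t ht
    refine ((hmem t ht).mul_const (lam f t)⁻¹).ae_eq (ae_of_all _ fun ω => ?_)
    rw [R, div_eq_mul_inv]
  · set A := eLpNorm (fun ω => gammaIntegral S f a ω - lam f a) (ENNReal.ofReal p) P with hA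
    have hAm : MemLp (fun ω => gammaIntegral S f a ω - lam f a) (ENNReal.ofReal p) P :=
      (hmem a ha).sub (memLp_const _)
    -- Both a and c are independent of t: A is a finite constant damped by `1 / λ_t f`, and undoing
    -- the scaling of the tail costs only the fixed factor `1 / c`.
    have hlim : Tendsto (fun t => ‖(lam f t)⁻¹‖ₑ * A + ‖c⁻¹‖ₑ * B t) atTop (𝓝 0) := by
      have h1 : Tendsto (fun t => ‖(lam f t)⁻¹‖ₑ) atTop (𝓝 0) := by
        simpa using (hdiv.inv_tendsto_atTop).enorm
      have h2 := ENNReal.Tendsto.mul_const h1 (Or.inr hAm.2.ne)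
      have h3 := ENNReal.Tendsto.const_mul (a := ‖c⁻¹‖ₑ) hB (Or.inr enorm_ne_top)
      simpa using h2.add h3
    refine tendsto_of_tendsto_of_tendsto_of_le_of_le' tendsto_const_nhds hlim
      (Eventually.of_forall fun _ => zero_le) ?_
    filter_upwards [eventually_ge_atTop a] with t ht
    have hYm : AEStronglyMeasurable (fun ω =>
        (∫ x in Ioc 0 (⌈t⌉₊ : ℝ), normalizedTail f a c t x ∂(pathMeasure (fun r => S r ω)))
          - ∫ x in Ioc 0 (⌈t⌉₊ : ℝ), normalizedTail f a c t x) P :=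
      ((hS.aemeasurable_integral_pathMeasure (hgm t) (Integrable.of_bound
        (hgm t).aestronglyMeasurable (1 / 2)
        (ae_of_all _ fun x => hg t x))).sub_const _).aestronglyMeasurable
    rw [eLpNorm_congr_ae (hS.R_sub_one_ae_eq hfm hloc ha ht (Nat.le_ceil t) hc0.ne'
      (hpos t ht).ne')]
    refine (eLpNorm_add_le (hAm.1.const_smul _) (hYm.const_smul _)
      (ENNReal.one_le_ofReal.2 hp1)).trans ?_
    rw [eLpNorm_const_smul, eLpNorm_const_smul]
    gcongr
    exact hS.eLpNorm_integral_sub_le hp0 hK hpK (hgm t) (hg t) _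

end IsGammaProcess

end OrderlyDivergence

theorem mainTheorem5 {Ω : Type*} [MeasurableSpace Ω] (P : Measure Ω) [IsProbabilityMeasure P]
    (S : ℝ≥0 → Ω → ℝ) (hS : OrderlyDivergence.IsGammaProcess S P)
    (f : ℝ → ℝ) (hfm : Measurable f) (hf : ∀ x, 0 ≤ x → 0 ≤ f x)
    (hloc : ∀ t, IntegrableOn f (Ioc 0 t))
    (hdiv : Tendsto (OrderlyDivergence.lam f) atTop atTop)
    (hb : ∃ C t₀ : ℝ, ∀ t, t₀ ≤ t → OrderlyDivergence.b f t ≤ C) :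
    (OrderlyDivergence.ODLp S P f 2 ↔ Tendsto (OrderlyDivergence.v f) atTop (𝓝 0)) ∧
    (OrderlyDivergence.ODLp S P f 2 →
      ∀ p : ℝ, 2 ≤ p →
        (∀ t, MemLp f (ENNReal.ofReal p) (volume.restrict (Ioc 0 t))) →
        OrderlyDivergence.ODLp S P f p) :=
  have h2 := hS.odLp_two_iff hfm hf hloc hdiv
  ⟨h2, fun h _ hp hfp => hS.odLp_of_tendsto_v hfm hf hloc hdiv hb (h2.1 h) hp hfp⟩
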